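/- **Setting.** Let $F:\mathbb R^n\times\mathbb R^m\to\mathbb R\cup\{+\infty\}$ be closed, proper and convex, with subdifferential $\partial F$. Put $$L(x,p)=\inf_{u}\{F(x,u)-\langle u,p\rangle\},\qquad D(s,p)=\inf_{x,u}\{F(x,u)-\langle u,p\rangle-\langle x,s\rangle\}.$$ The primal problem is $\min_x F(x,0)$ and the dual problem is $\max_p D(0,p)$; $p$ is dual optimal if it maximizes the extended-real-valued function $D(0,\cdot)$. A *compatible subproblem process* for $(F,p,c)$, where $c>0$, is a sequence $\{(x^j,u^j,s^j)\}_{j\ge0}$ such that $s^j\to0$, $\langle x^j,s^j\rangle\to0$, and $(s^j,0)\in\partial F(x^j,u^j)+(0,cu^j-p)$ for all $j\ge0$. **Algorithm.** Given are $p^0\in\mathbb R^m$, $w^0=0\in\mathbb R^n$, $c_{\min}>0$ and $\epsilon\in(0,1)$. For $k=0,1,2,\dots$ (outer loop): choose $c_k>c_{\min}$, and let $\{(x^{k,j},u^{k,j},s^{k,j})\}_{j\ge0}$ be any compatible subproblem process for $(F,p^k,c_k)$. For $j=1,2,\dots$ (inner loop) compute $$U_{k,j}=\|u^{k,j}\|^2,\quad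 S_{k,j}=\|s^{k,j}\|^2,\quad A_{k,j}=\tfrac1{c_k}|\langle x^{k,j}-w^k,s^{k,j}\rangle|,\quad \Delta_{k,j}=(U_{k,j}-A_{k,j})^2-\epsilon U_{k,j}(U_{k,j}+S_{k,j}),$$ until $A_{k,j}<U_{k,j}$ and $\Delta_{k,j}\ge0$. With this $j$, set $(x^{k+1},u^{k+1},s^{k+1})=(x^{k,j},u^{k,j},s^{k,j})$ and $(U_k,S_k,A_k,\Delta_k)=(U_{k,j},S_{k,j},A_{k,j},\Delta_{k,j})$. Let $\gamma_k^{\min}=\max\{-1,(A_k-U_k)/\sqrt{\Delta_k}\}$ (read as $-1$ if $\Delta_k=0$), choose any $\gamma_k\in(\gamma_k^{\min},1]$, and set $$\rho_k=\frac{U_k-A_k+\gamma_k\sqrt{\Delta_k}}{U_k+S_k},\quad w^{k+1}=w^k-\rho_kc_ks^{k+1},\quad \bar p^k=p^k-c_ku^{k+1},\quad p^{k+1}=(1-\rho_k)p^k+\rho_k\bar p^k.$$ **Proposition 3.6.** Whenever an inner loop stops, the interval $(\gamma_k^{\min},1]$ is nonempty and $U_k+S_k>0$, so that the updates can be carried out.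 Every execution of the algorithm has one of the following two outcomes. (i) Every inner loop terminates finitely, so the outer loop runs indefinitely. In this case, if $L$ has a saddle point, then: - $\{\bar p^k\}$, $\{p^k\}$ and $\{w^k\}$ are bounded; - $u^k\to0$, $c_ku^{k+1}\to0$ and $s^k\to0$; - the primal and dual optimal values are the same real number, and $F(x^k,u^k)$ and $D(s^{k+1},\bar p^k)$ both converge to it; - every accumulation point of $\{x^k\}$ solves the primal problem; - every accumulation point of $\{\bar p^k\}$ or of $\{p^k\}$ solves the dual problem. If $L$ has no saddle point, then at least one of $\{x^k\}$, $\{\bar p^k\}$ is unbounded. (ii) For some $k$, the algorithm enters outer iteration $k$ and its inner loop runs indefinitely. In this case $p^k$ is dual optimal, $\limsup_{j\to\infty}F(x^{k,j},u^{k,j})\le\inf_{x}F(x,0)$, and $\lim_{j\to\infty}u^{k,j}=0$. -/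

import Mathlib

open Filter Topology

noncomputable section

namespace AdaptiveRelax

/-- Real Euclidean space of dimension `n`. -/
abbrev Vec (n : ℕ) : Type := EuclideanSpace ℝ (Fin n)

/-! ### Parametric convex duality -/

/-- `F : ℝⁿ × ℝᵐ → ℝ ∪ {+∞}` is closed, proper and convex: it never takes the value `-∞`, it is
not identically `+∞`, it is lower semicontinuous and its epigraph is convex. -/
structure ClosedProperConvex {n m : ℕ} (F : Vec n × Vec m → EReal) : Prop where
  ne_bot : ∀ z, F z ≠ ⊥
  exists_ne_top : ∃ z, F z ≠ ⊤
  lowerSemicontinuous : LowerSemicontinuous F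
  convex_epigraph : Convex ℝ {q : (Vec n × Vec m) × ℝ | F q.1 ≤ (q.2 : EReal)}

/-- The subdifferential `∂F(x, u)`: the set of all `(s, v)` such that
`F(x', u') ≥ F(x, u) + ⟨s, x' - x⟩ + ⟨v, u' - u⟩` for all `(x', u')`. -/
def subdifferential {n m : ℕ} (F : Vec n × Vec m → EReal) (x : Vec n) (u : Vec m) :
    Set (Vec n × Vec m) :=
  {g | ∀ (x' : Vec n) (u' : Vec m),
    F (x, u) + ((inner ℝ g.1 (x' - x) + inner ℝ g.2 (u' - u) : ℝ) : EReal) ≤ F (x', u')}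

/-- The Lagrangian `L(x, p) = inf_u {F(x, u) - ⟨u, p⟩}`. -/
def lagrangian {n m : ℕ} (F : Vec n × Vec m → EReal) (x : Vec n) (p : Vec m) : EReal :=
  ⨅ u : Vec m, F (x, u) - ((inner ℝ u p : ℝ) : EReal)

/-- The full concave conjugate `D(s, p) = inf_{x, u} {F(x, u) - ⟨u, p⟩ - ⟨x, s⟩}`. -/
def dualFunction {n m : ℕ} (F : Vec n × Vec m → EReal) (s : Vec n) (p : Vec m) : EReal :=
  ⨅ (x : Vec n) (u : Vec m),
    F (x, u) - ((inner ℝ u p : ℝ) : EReal) - ((inner ℝ x s : ℝ) : EReal)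

/-- `(x, p)` is a saddle point of `L`: `x` minimizes `L(·, p)` and `p` maximizes `L(x, ·)`. -/
def IsSaddlePoint {n m : ℕ} (F : Vec n × Vec m → EReal) (x : Vec n) (p : Vec m) : Prop :=
  (∀ p' : Vec m, lagrangian F x p' ≤ lagrangian F x p) ∧
    (∀ x' : Vec n, lagrangian F x p ≤ lagrangian F x' p)

/-- The optimal value `inf_x F(x, 0)` of the primal problem. -/
def primalValue {n m : ℕ} (F : Vec n × Vec m → EReal) : EReal :=
  ⨅ x : Vec n, F (x, 0)

/-- The optimal value `sup_p D(0, p)` of the dual problem. -/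
def dualValue {n m : ℕ} (F : Vec n × Vec m → EReal) : EReal :=
  ⨆ p : Vec m, dualFunction F 0 p

/-- `x` solves the primal problem of minimizing `F(·, 0)`. -/
def IsPrimalSolution {n m : ℕ} (F : Vec n × Vec m → EReal) (x : Vec n) : Prop :=
  ∀ x' : Vec n, F (x, 0) ≤ F (x', 0)

/-- `p` solves the dual problem of maximizing `D(0, ·)`. -/
def IsDualSolution {n m : ℕ} (F : Vec n × Vec m → EReal) (p : Vec m) : Prop :=
  ∀ p' : Vec m, dualFunction F 0 p' ≤ dualFunction F 0 p

/-! ### The algorithm -/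

/-- A compatible subproblem process for `(F, p, c)`: a sequence `(x j, u j, s j)`, `j ≥ 0`, with
`s j → 0`, `⟨x j, s j⟩ → 0` and `(s j, 0) ∈ ∂F(x j, u j) + (0, c u j - p)` for all `j`. -/
structure CompatibleProcess {n m : ℕ} (F : Vec n × Vec m → EReal) (p : Vec m) (c : ℝ)
    (x : ℕ → Vec n) (u : ℕ → Vec m) (s : ℕ → Vec n) : Prop where
  tendsto_s : Tendsto s atTop (𝓝 0)
  tendsto_inner : Tendsto (fun j => inner ℝ (x j) (s j)) atTop (𝓝 (0 : ℝ))
  subgrad : ∀ j, ∃ g ∈ subdifferential F (x j) (u j),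
    (s j, (0 : Vec m)) = g + ((0 : Vec n), c • u j - p)

/-- The quantities appearing in the algorithm. Index conventions: the outer iterates `x`, `u`, `s`
start at index `1` (their entry `0` is unused), all other outer sequences start at index `0`;
`xs k j`, `us k j`, `ss k j` are the inner iterates `x^{k,j}`, `u^{k,j}`, `s^{k,j}`. -/
structure Trace (n m : ℕ) where
  c : ℕ → ℝ
  γ : ℕ → ℝ
  ρ : ℕ → ℝ
  x : ℕ → Vec n
  u : ℕ → Vec m
  s : ℕ → Vec n
  w : ℕ → Vec n
  p : ℕ → Vec m
  pbar : ℕ → Vec m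
  xs : ℕ → ℕ → Vec n
  us : ℕ → ℕ → Vec m
  ss : ℕ → ℕ → Vec n

namespace Trace

variable {n m : ℕ}

/-- `U_{k,j} = ‖u^{k,j}‖²`. -/
def U (t : Trace n m) (k j : ℕ) : ℝ := ‖t.us k j‖ ^ 2

/-- `S_{k,j} = ‖s^{k,j}‖²`. -/
def S (t : Trace n m) (k j : ℕ) : ℝ := ‖t.ss k j‖ ^ 2

/-- `A_{k,j} = (1 / c_k) |⟨x^{k,j} - w^k, s^{k,j}⟩|`. -/
def A (t : Trace n m) (k j : ℕ) : ℝ :=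
  (1 / t.c k) * |inner ℝ (t.xs k j - t.w k) (t.ss k j)|

/-- `Δ_{k,j} = (U_{k,j} - A_{k,j})² - ε U_{k,j} (U_{k,j} + S_{k,j})`. -/
def Δ (t : Trace n m) (ε : ℝ) (k j : ℕ) : ℝ :=
  (t.U k j - t.A k j) ^ 2 - ε * t.U k j * (t.U k j + t.S k j)

/-- The stopping test of the inner loop: `A_{k,j} < U_{k,j}` and `Δ_{k,j} ≥ 0`. -/
def Stop (t : Trace n m) (ε : ℝ) (k j : ℕ) : Prop :=
  t.A k j < t.U k j ∧ 0 ≤ t.Δ ε k j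

/-- The inner loop of outer iteration `k`, which runs over `j = 1, 2, …`, terminates. -/
def InnerTerminates (t : Trace n m) (ε : ℝ) (k : ℕ) : Prop :=
  ∃ j, 1 ≤ j ∧ t.Stop ε k j

/-- The inner loop of outer iteration `k` stops exactly at `j`. -/
def StopsAt (t : Trace n m) (ε : ℝ) (k j : ℕ) : Prop :=
  1 ≤ j ∧ t.Stop ε k j ∧ ∀ i, 1 ≤ i → i < j → ¬ t.Stop ε k i

/-- Outer iteration `k` is entered: all previous inner loops have terminated. -/
def Reached (t : Trace n m) (ε : ℝ) (k : ℕ) : Prop :=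
  ∀ i, i < k → t.InnerTerminates ε i

/-- `γ_k^min = max {-1, (A_k - U_k) / √Δ_k}`, where the negative number `A_k - U_k` divided by
zero is read as `-∞`, so that the value is `-1` if `Δ_k = 0`. -/
def gammaMin (t : Trace n m) (ε : ℝ) (k j : ℕ) : ℝ :=
  open Classical in
  if t.Δ ε k j = 0 then -1 else max (-1) ((t.A k j - t.U k j) / √(t.Δ ε k j))

/-- `t` is an execution of the algorithm: `w⁰ = 0` (`p⁰` is arbitrary); in each outer iteration `k`
that is entered, `c_k > c_min` and the inner iterates are a compatible subproblem process for
`(F, p^k, c_k)`; and if the inner loop stops, at `j`, the updates are carried out. Nothing is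
required of the entries that are never computed. -/
structure IsExecution (t : Trace n m) (F : Vec n × Vec m → EReal) (cmin ε : ℝ) : Prop where
  w_zero : t.w 0 = 0
  c_gt : ∀ k, t.Reached ε k → cmin < t.c k
  process : ∀ k, t.Reached ε k →
    CompatibleProcess F (t.p k) (t.c k) (t.xs k) (t.us k) (t.ss k)
  x_succ : ∀ k j, t.Reached ε k → t.StopsAt ε k j → t.x (k + 1) = t.xs k j
  u_succ : ∀ k j, t.Reached ε k → t.StopsAt ε k j → t.u (k + 1) = t.us k j
  s_succ : ∀ k j, t.Reached ε k → t.StopsAt ε k j → t.s (k + 1) = t.ss k j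
  γ_mem : ∀ k j, t.Reached ε k → t.StopsAt ε k j → t.γ k ∈ Set.Ioc (t.gammaMin ε k j) 1
  ρ_eq : ∀ k j, t.Reached ε k → t.StopsAt ε k j →
    t.ρ k = (t.U k j - t.A k j + t.γ k * √(t.Δ ε k j)) / (t.U k j + t.S k j)
  w_succ : ∀ k j, t.Reached ε k → t.StopsAt ε k j →
    t.w (k + 1) = t.w k - (t.ρ k * t.c k) • t.s (k + 1)
  pbar_eq : ∀ k j, t.Reached ε k → t.StopsAt ε k j →
    t.pbar k = t.p k - t.c k • t.u (k + 1)
  p_succ : ∀ k j, t.Reached ε k → t.StopsAt ε k j →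
    t.p (k + 1) = (1 - t.ρ k) • t.p k + t.ρ k • t.pbar k

/-- The convergence conclusions about the outer sequences. -/
structure Converges (t : Trace n m) (F : Vec n × Vec m → EReal) : Prop where
  bounded_pbar : Bornology.IsBounded (Set.range t.pbar)
  bounded_p : Bornology.IsBounded (Set.range t.p)
  bounded_w : Bornology.IsBounded (Set.range t.w)
  tendsto_u : Tendsto (fun k => t.u (k + 1)) atTop (𝓝 0)
  tendsto_cu : Tendsto (fun k => t.c k • t.u (k + 1)) atTop (𝓝 0)
  tendsto_s : Tendsto (fun k => t.s (k + 1)) atTop (𝓝 0)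
  /-- The primal and dual optimal values are the same real number, and both `F(x^k, u^k)` and
  `D(s^{k+1}, p̄^k)` converge to it. -/
  tendsto_values : ∃ v : ℝ, primalValue F = (v : EReal) ∧ dualValue F = (v : EReal) ∧
    Tendsto (fun k => F (t.x (k + 1), t.u (k + 1))) atTop (𝓝 (v : EReal)) ∧
    Tendsto (fun k => dualFunction F (t.s (k + 1)) (t.pbar k)) atTop (𝓝 (v : EReal))
  clusterPt_x : ∀ x' : Vec n, MapClusterPt x' atTop (fun k => t.x (k + 1)) →
    IsPrimalSolution F x'
  clusterPt_pbar : ∀ p' : Vec m, MapClusterPt p' atTop t.pbar → IsDualSolution F p'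
  clusterPt_p : ∀ p' : Vec m, MapClusterPt p' atTop t.p → IsDualSolution F p'

end Trace

end AdaptiveRelax

end

open Filter Topology

noncomputable section

namespace AdaptiveRelax

/-! ### Separation arguments -/

/-! The stopping test makes the quadratic (U+S)ρ² - 2(U-A)ρ + εU have real positive roots, and ρ_k
lies between them because γ_k² ≤ 1. Nonpositivity of this quadratic is what a Fejér argument needs
(`RelaxedIteration.fejer`): ‖w - x'‖² + ‖p - p'‖² drops by at least ε‖c u‖² in each outer iteration,
for every (x', p') such that ⟨x - x', s⟩ + ⟨pbar - p', u⟩ ≥ 0 along all iterates. Hence w and p stay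
bounded and c u → 0. Then u → 0 since c > c_min, s → 0 since the test forces S ≤ U/ε, and ⟨x, s⟩ → 0
since A < U. The subgradient inequalities of the iterates therefore pass to the limit along
subsequences.

If L has a saddle point, closedness of F turns it into a Kuhn–Tucker pair, and monotonicity of ∂F
supplies the required (x', p'). If x and pbar are bounded but no saddle point is assumed, a
Debrunner–Flor argument still yields some (x', p') satisfying these inequalities at the iterates
alone. The Fejér argument then applies as before, and an accumulation point of (x, pbar), not (x',
p') itself, is shown to be a saddle point. This gives the unboundedness claim by contraposition.

If an inner loop never stops, each failed test gives (1-ε)U ≤ 2A + S. For a compatible process A and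
S vanish, so u → 0 and the subgradient inequality again passes to the limit. -/

/-- A closed convex set that is upward closed in its last coordinate, and is not a union of vertical
lines, lies above an affine function through any given point of the vertical axis outside of it. -/
theorem exists_affine_minorant {E : Type*} [NormedAddCommGroup E] [NormedSpace ℝ E]
    {C : Set (E × ℝ)} (hconv : Convex ℝ C) (hclosed : IsClosed C)
    (hup : ∀ u t t', (u, t) ∈ C → t ≤ t' → (u, t') ∈ C)
    {u₀ : E} {t₀ t₁ : ℝ} (h₀ : (u₀, t₀) ∈ C) (h₁ : (u₀, t₁) ∉ C)
    {r : ℝ} (hr : ((0 : E), r) ∉ C) :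
    ∃ l : E →L[ℝ] ℝ, ∀ u t, (u, t) ∈ C → r + l u ≤ t := by
  have key : ∀ v q, ((v, q) : E × ℝ) ∉ C → ∃ (a : E →L[ℝ] ℝ) (β b : ℝ), 0 ≤ β ∧
      a v + β * q < b ∧ ∀ u t, (u, t) ∈ C → b < a u + β * t := by
    intro v q hvq
    obtain ⟨L, b, hlt, hgt⟩ := geometric_hahn_banach_point_closed hconv hclosed hvq
    have hL : ∀ u t, L (u, t) = L.comp (.inl ℝ E ℝ) u + L (0, 1) * t := by
      intro u t
      have : ((u, t) : E × ℝ) = (u, 0) + t • (0, 1) := by simp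
      rw [this, map_add, map_smul]
      simp [mul_comm]
    refine ⟨L.comp (.inl ℝ E ℝ), L (0, 1), b, ?_, by rw [← hL]; exact hlt,
      fun u t h => by rw [← hL]; exact hgt _ h⟩
    -- With a negative vertical coefficient, climbing from `(u₀, t₀)` inside `C` would bring the
    -- functional down to the threshold `b`; the chosen height does so.
    by_contra! hneg
    set a := L.comp (.inl ℝ E ℝ) u₀
    have hT := hgt _ (hup u₀ t₀ (max t₀ ((b - a) / L (0, 1))) h₀ (le_max_left _ _))
    rw [hL] at hT
    have h2 : L (0, 1) * max t₀ ((b - a) / L (0, 1)) ≤ L (0, 1) * ((b - a) / L (0, 1)) :=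
      mul_le_mul_of_nonpos_left (le_max_right _ _) hneg.le
    rw [mul_div_cancel₀ _ hneg.ne] at h2
    linarith
  obtain ⟨a, β, b, hβ, hlt, hgt⟩ := key 0 r hr
  rw [map_zero, zero_add] at hlt
  rcases hβ.lt_or_eq with hβ | rfl
  · refine ⟨-(β⁻¹ • a), fun u t h => ?_⟩
    have := hlt.trans (hgt u t h)
    have h2 : r < β⁻¹ * (a u + β * t) := by
      rw [lt_inv_mul_iff₀ hβ]; exact this
    rw [mul_add, inv_mul_cancel_left₀ hβ.ne'] at h2
    simp only [_root_.neg_apply, _root_.smul_apply, smul_eq_mul]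
    linarith
  -- The separating hyperplane is vertical. A second one, below the point `(u₀, t₀)` of `C`, cannot
  -- be; adding a large multiple `M` of the vertical one raises its height at the origin to at least
  -- `r` and keeps it below `C`.
  · obtain ⟨a', β', b', hβ', hlt', hgt'⟩ := key u₀ t₁ h₁
    have ht : t₁ < t₀ := by
      by_contra! h
      exact h₁ (hup _ _ _ h₀ h)
    have hβ'' : 0 < β' := by
      refine hβ'.lt_of_ne ?_
      rintro rfl
      have := hgt' _ _ h₀
      linarith
    have hb : 0 < b := by simpa using hlt
    obtain ⟨M, hM0, hM⟩ : ∃ M : ℝ, 0 ≤ M ∧ r ≤ b' / β' + M * b := by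
      refine ⟨max 0 ((r - b' / β') / b), le_max_left _ _, ?_⟩
      have := mul_le_mul_of_nonneg_right (le_max_right 0 ((r - b' / β') / b)) hb.le
      rw [div_mul_cancel₀ _ hb.ne'] at this
      linarith
    refine ⟨-(β'⁻¹ • a') - M • a, fun u t h => ?_⟩
    have e1 := hgt u t h
    have e2 : β'⁻¹ * b' < β'⁻¹ * (a' u + β' * t) :=
      mul_lt_mul_of_pos_left (hgt' u t h) (inv_pos.2 hβ'')
    rw [mul_add, inv_mul_cancel_left₀ hβ''.ne', inv_mul_eq_div] at e2
    have e3 : M * b ≤ M * a u := mul_le_mul_of_nonneg_left (by linarith) hM0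
    simp only [_root_.sub_apply, _root_.neg_apply,
      _root_.smul_apply, smul_eq_mul]
    linarith

/-- A square matrix with nonnegative symmetric part maps some probability vector to a
nonnegative vector. -/
theorem exists_mem_stdSimplex_mulVec_nonneg {ι : Type*} [Fintype ι] [Nonempty ι]
    (M : ι → ι → ℝ) (hM : ∀ i j, 0 ≤ M i j + M j i) :
    ∃ l ∈ stdSimplex ℝ ι, ∀ i, 0 ≤ ∑ j, l j * M i j := by
  classical
  -- Otherwise the compact image of the simplex can be separated strictly from the nonnegative
  -- orthant. The coefficients `q` of the separating functional are nonnegative; tested on the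
  -- normalized `q`, the functional is a positive multiple of ∑ q_i q_j M_ij ≥ 0, whereas separation
  -- makes it negative.
  by_contra! hcon
  let T : (ι → ℝ) →ₗ[ℝ] (ι → ℝ) := Matrix.mulVecLin (Matrix.of M)
  have hT : ∀ l i, T l i = ∑ j, l j * M i j := by
    intro l i
    simp [T, Matrix.mulVec, dotProduct, mul_comm]
  have hTc : Continuous T := T.continuous_of_finiteDimensional
  obtain ⟨φ, a, b, h1, hab, h2⟩ := geometric_hahn_banach_compact_closed
    ((convex_stdSimplex ℝ ι).linear_image T) ((isCompact_stdSimplex ℝ ι).image hTc)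
    (convex_Ici (𝕜 := ℝ) (0 : ι → ℝ)) isClosed_Ici
    (by
      rw [Set.disjoint_left]
      rintro _ ⟨l, hl, rfl⟩ hv
      obtain ⟨i, hi⟩ := hcon l hl
      have := hv i
      rw [hT] at this
      exact absurd this (not_le.2 hi))
  have hφ : ∀ v, φ v = ∑ i, v i * φ (Pi.single i 1) := by
    intro v
    conv_lhs => rw [pi_eq_sum_univ' v]
    simp [map_sum]
  have hb0 : b < 0 := by simpa using h2 0 (Set.mem_Ici.2 le_rfl)
  -- If a coefficient were negative, a nonnegative multiple of the basis vector would attain the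
  -- value `b` exactly.
  have hφ0 : ∀ i, 0 ≤ φ (Pi.single i 1) := by
    intro i
    by_contra! hneg
    have := h2 ((b / φ (Pi.single i 1)) • Pi.single i 1) (by
      refine Set.mem_Ici.2 (smul_nonneg (div_nonneg_of_nonpos hb0.le hneg.le) ?_)
      exact Pi.single_nonneg.2 zero_le_one)
    rw [map_smul, smul_eq_mul, div_mul_cancel₀ _ hneg.ne] at this
    exact lt_irrefl _ this
  set q : ι → ℝ := fun i => φ (Pi.single i 1) with hq
  have hs : 0 < ∑ i, q i := by
    refine (Finset.sum_nonneg fun i _ => hφ0 i).lt_of_ne fun h => ?_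
    have hz : ∀ i, q i = 0 := fun i =>
      (Finset.sum_eq_zero_iff_of_nonneg (fun i _ => hφ0 i)).1 h.symm i (Finset.mem_univ i)
    obtain ⟨i⟩ := ‹Nonempty ι›
    have := h1 _ ⟨_, single_mem_stdSimplex ℝ i, rfl⟩
    rw [hφ] at this
    simp only [show ∀ i, φ (Pi.single i 1) = 0 from hz, mul_zero, Finset.sum_const_zero] at this
    linarith
  have hmem : (∑ i, q i)⁻¹ • q ∈ stdSimplex ℝ ι := by
    refine ⟨fun i => mul_nonneg (inv_nonneg.2 hs.le) (hφ0 i), ?_⟩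
    simp only [Pi.smul_apply, smul_eq_mul, ← Finset.mul_sum]
    exact inv_mul_cancel₀ hs.ne'
  have hlt := h1 _ ⟨_, hmem, rfl⟩
  rw [map_smul, map_smul, smul_eq_mul, hφ] at hlt
  have hsum : ∑ i, T q i * φ (Pi.single i 1) = ∑ i, ∑ j, q i * q j * M i j := by
    refine Finset.sum_congr rfl fun i _ => ?_
    rw [hT, Finset.sum_mul]
    exact Finset.sum_congr rfl fun j _ => by simp only [hq]; ring
  have hnn : 0 ≤ ∑ i, ∑ j, q i * q j * M i j := by
    have hsymm : ∑ i, ∑ j, q i * q j * M i j = ∑ i, ∑ j, q i * q j * M j i := by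
      rw [Finset.sum_comm]
      exact Finset.sum_congr rfl fun i _ => Finset.sum_congr rfl fun j _ => by ring
    have h2 : 0 ≤ ∑ i, ∑ j, q i * q j * (M i j + M j i) :=
      Finset.sum_nonneg fun i _ => Finset.sum_nonneg fun j _ =>
        mul_nonneg (mul_nonneg (hφ0 i) (hφ0 j)) (hM i j)
    simp only [mul_add, Finset.sum_add_distrib] at h2
    linarith
  rw [hsum] at hlt
  have := mul_nonneg (inv_nonneg.2 hs.le) hnn
  linarith

/-- **Debrunner–Flor extension.** Points `z i` of a compact convex set
with functionals `g i` forming a monotone family admit a common solution of the variational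
inequalities `0 ≤ g i (z i - z')`. -/
theorem exists_forall_nonneg_of_monotone {E ι : Type*} [NormedAddCommGroup E] [NormedSpace ℝ E]
    {K : Set E} (hK : IsCompact K) (hKc : Convex ℝ K) (hKne : K.Nonempty)
    (z : ι → E) (hz : ∀ i, z i ∈ K) (g : ι → E →L[ℝ] ℝ)
    (hmono : ∀ i j, 0 ≤ g i (z i - z j) + g j (z j - z i)) :
    ∃ z' ∈ K, ∀ i, 0 ≤ g i (z i - z') := by
  have hcl : ∀ i, IsClosed {z' | 0 ≤ g i (z i - z')} := fun i =>
    isClosed_le continuous_const (by fun_prop)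
  -- By compactness finite subfamilies suffice. For these, a convex combination z' = ∑ l_j z_j gives
  -- g_i(z_i - z') = ∑ l_j g_i(z_i - z_j), so the weights come from the matrix lemma.
  have hne := hK.inter_iInter_nonempty _ hcl (fun J => by
    rcases J.eq_empty_or_nonempty with rfl | hJ
    · simpa using hKne
    have : Nonempty J := hJ.to_subtype
    obtain ⟨l, hl, hl2⟩ := exists_mem_stdSimplex_mulVec_nonneg
      (fun i j : J => g i (z i - z j)) (fun i j => hmono i j)
    refine ⟨∑ j, l j • z j, hKc.sum_mem (fun j _ => hl.1 j) hl.2 (fun j _ => hz j), ?_⟩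
    simp only [Set.mem_iInter]
    intro i hi
    have h := hl2 ⟨i, hi⟩
    have e : z i - ∑ j : J, l j • z j = ∑ j : J, l j • (z i - z j) := by
      simp only [smul_sub, Finset.sum_sub_distrib, ← Finset.sum_smul]
      rw [hl.2, one_smul]
    rw [Set.mem_ofPred_eq, e, map_sum]
    simpa using h)
  obtain ⟨z', hz'K, hz'⟩ := hne
  exact ⟨z', hz'K, fun i => Set.mem_iInter.1 hz' i⟩

/-! ### Optimality conditions -/

section Duality

variable {n m : ℕ} {F : Vec n × Vec m → EReal}

theorem ClosedProperConvex.isClosed_epigraph (hF : ClosedProperConvex F) :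
    IsClosed {q : (Vec n × Vec m) × ℝ | F q.1 ≤ (q.2 : EReal)} := by
  have h := hF.lowerSemicontinuous.isClosed_epigraph
  exact h.preimage (f := fun q : (Vec n × Vec m) × ℝ => (q.1, (q.2 : EReal)))
    (continuous_fst.prodMk (continuous_coe_real_ereal.comp continuous_snd))

theorem ClosedProperConvex.exists_eq_coe (hF : ClosedProperConvex F) {z : Vec n × Vec m}
    (h : F z ≠ ⊤) : ∃ t : ℝ, F z = (t : EReal) :=
  ⟨(F z).toReal, (EReal.coe_toReal h (hF.ne_bot z)).symm⟩

theorem ClosedProperConvex.le_of_tendsto (hF : ClosedProperConvex F) {z : ℕ → Vec n × Vec m}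
    {z' : Vec n × Vec m} {b : ℕ → ℝ} {b' : ℝ} {l : Filter ℕ} [l.NeBot]
    (hz : Tendsto z l (𝓝 z')) (hb : Tendsto b l (𝓝 b')) (h : ∀ k, F (z k) ≤ (b k : EReal)) :
    F z' ≤ (b' : EReal) :=
  hF.isClosed_epigraph.mem_of_tendsto (hz.prodMk_nhds hb) (Eventually.of_forall h)

theorem coe_le_sub_coe_iff {a b : ℝ} {y : EReal} :
    (a : EReal) ≤ y - (b : EReal) ↔ ((a + b : ℝ) : EReal) ≤ y := by
  rw [EReal.le_sub_iff_add_le (.inl (EReal.coe_ne_bot _)) (.inl (EReal.coe_ne_top _)),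
    EReal.coe_add]

/-- `v` is the value of `F` at `(x, 0)` and `(0, p) ∈ ∂F(x, 0)`. -/
def IsKuhnTucker (F : Vec n × Vec m → EReal) (x : Vec n) (p : Vec m) (v : ℝ) : Prop :=
  F (x, 0) = (v : EReal) ∧ ∀ z ζ, ((v + inner ℝ p ζ : ℝ) : EReal) ≤ F (z, ζ)

theorem coe_le_lagrangian {x : Vec n} {p : Vec m} {v : ℝ}
    (h : ∀ ζ, ((v + inner ℝ p ζ : ℝ) : EReal) ≤ F (x, ζ)) : (v : EReal) ≤ lagrangian F x p :=
  le_iInf fun ζ => coe_le_sub_coe_iff.2 (by rw [real_inner_comm]; exact h ζ)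

theorem lagrangian_le (x : Vec n) (p : Vec m) : lagrangian F x p ≤ F (x, 0) :=
  (iInf_le _ 0).trans (by simp)

theorem coe_le_dualFunction_zero {p : Vec m} {v : ℝ}
    (h : ∀ z ζ, ((v + inner ℝ p ζ : ℝ) : EReal) ≤ F (z, ζ)) :
    (v : EReal) ≤ dualFunction F 0 p :=
  le_iInf₂ fun z ζ => by
    rw [coe_le_sub_coe_iff, coe_le_sub_coe_iff, inner_zero_right, add_zero, real_inner_comm]
    exact h z ζ

theorem dualFunction_zero_le (p : Vec m) (x : Vec n) (u : Vec m) {f : ℝ} (h : F (x, u) = f) :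
    dualFunction F 0 p ≤ ((f - inner ℝ u p : ℝ) : EReal) :=
  (iInf₂_le x u).trans (by rw [h, inner_zero_right, EReal.coe_sub]; simp)

theorem dualFunction_zero_le_primalValue (p : Vec m) : dualFunction F 0 p ≤ primalValue F :=
  le_iInf fun x => (iInf₂_le x 0).trans (by simp)

theorem IsKuhnTucker.isSaddlePoint {x : Vec n} {p : Vec m} {v : ℝ} (h : IsKuhnTucker F x p v) :
    IsSaddlePoint F x p := by
  have hx : lagrangian F x p = v :=
    le_antisymm ((lagrangian_le x p).trans h.1.le) (coe_le_lagrangian (h.2 x))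
  refine ⟨fun p' => ?_, fun x' => ?_⟩
  · rw [hx]; exact (lagrangian_le x p').trans h.1.le
  · rw [hx]; exact coe_le_lagrangian (h.2 x')

theorem IsKuhnTucker.primalValue_eq {x : Vec n} {p : Vec m} {v : ℝ} (h : IsKuhnTucker F x p v) :
    primalValue F = v :=
  le_antisymm ((iInf_le _ x).trans h.1.le) (le_iInf fun z => by simpa using h.2 z 0)

theorem IsKuhnTucker.dualValue_eq {x : Vec n} {p : Vec m} {v : ℝ} (h : IsKuhnTucker F x p v) :
    dualValue F = v :=
  le_antisymm (iSup_le fun q => (dualFunction_zero_le_primalValue q).trans h.primalValue_eq.le)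
    ((coe_le_dualFunction_zero h.2).trans (le_iSup _ p))

/-- A partial function of a closed proper convex function is minorized by an affine function
whose value at the origin is arbitrarily close to the value of the function. -/
theorem ClosedProperConvex.exists_coe_le_lagrangian (hF : ClosedProperConvex F) {x : Vec n}
    {ζ₀ : Vec m} (h₀ : F (x, ζ₀) ≠ ⊤) {r : ℝ} (hr : (r : EReal) < F (x, 0)) :
    ∃ p, (r : EReal) ≤ lagrangian F x p := by
  obtain ⟨t₀, ht₀⟩ := hF.exists_eq_coe h₀
  let C : Set (Vec m × ℝ) := {q | F (x, q.1) ≤ (q.2 : EReal)}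
  have hmem : ∀ ζ t, (ζ, t) ∈ C ↔ F (x, ζ) ≤ (t : EReal) := fun _ _ => Iff.rfl
  have hcl : IsClosed C := hF.isClosed_epigraph.preimage
    (f := fun q : Vec m × ℝ => (((x, q.1), q.2) : (Vec n × Vec m) × ℝ)) (by fun_prop)
  have hconv : Convex ℝ C := by
    intro q hq q' hq' a b ha hb hab
    have := hF.convex_epigraph (x := ((x, q.1), q.2)) hq (y := ((x, q'.1), q'.2)) hq' ha hb hab
    simpa [C, ← add_smul, hab] using this
  obtain ⟨l, hl⟩ := exists_affine_minorant hconv hcl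
    (fun u t t' h ht => (hmem _ _).2 (((hmem _ _).1 h).trans (EReal.coe_le_coe_iff.2 ht)))
    ((hmem ζ₀ t₀).2 ht₀.le)
    (t₁ := t₀ - 1) (by
      rw [hmem, ht₀, EReal.coe_le_coe_iff]; linarith)
    (r := r) (by rw [hmem]; exact not_le.2 hr)
  refine ⟨(InnerProductSpace.toDual ℝ (Vec m)).symm l, coe_le_lagrangian fun ζ => ?_⟩
  rw [InnerProductSpace.toDual_symm_apply]
  by_cases hζ : F (x, ζ) = ⊤
  · rw [hζ]; exact le_top
  · obtain ⟨t, ht⟩ := hF.exists_eq_coe hζ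
    rw [ht, EReal.coe_le_coe_iff]
    exact hl ζ t ((hmem _ _).2 ht.le)

/-- Closedness and convexity give F(x, 0) = sup_p L(x, p), provided F(x, ·) is not identically +∞;
minimality of x, compared with a point of the domain of F, ensures this. Maximality of p then forces
F(x, 0) ≤ L(x, p), which minimality in x turns into a global affine minorant. -/
theorem IsSaddlePoint.exists_isKuhnTucker (hF : ClosedProperConvex F) {x : Vec n} {p : Vec m}
    (h : IsSaddlePoint F x p) : ∃ v : ℝ, IsKuhnTucker F x p v := by
  obtain ⟨⟨z₀, ζ₁⟩, hz₀⟩ := hF.exists_ne_top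
  obtain ⟨t₀, ht₀⟩ := hF.exists_eq_coe hz₀
  have hlt : lagrangian F x p < ⊤ := by
    refine ((h.2 z₀).trans (iInf_le _ ζ₁)).trans_lt ?_
    rw [ht₀, ← EReal.coe_sub]
    exact EReal.coe_lt_top _
  obtain ⟨ζ₀, hζ₀⟩ : ∃ ζ₀, F (x, ζ₀) ≠ ⊤ := by
    by_contra! hcon
    refine hlt.ne ?_
    simp [lagrangian, hcon]
  have hle : F (x, 0) ≤ lagrangian F x p := by
    by_contra! hlt'
    obtain ⟨r, h1, h2⟩ := EReal.lt_iff_exists_real_btwn.1 hlt'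
    obtain ⟨p', hp'⟩ := hF.exists_coe_le_lagrangian hζ₀ h2
    exact (hp'.trans (h.1 p')).not_gt h1
  obtain ⟨v, hv⟩ := hF.exists_eq_coe (hle.trans_lt hlt).ne
  refine ⟨v, hv, fun z ζ => ?_⟩
  rw [real_inner_comm, ← coe_le_sub_coe_iff, ← hv]
  exact (hle.trans (h.2 z)).trans (iInf_le _ ζ)

/-- The subgradient inequality of a compatible subproblem process, with a real value of `F`. -/
theorem ClosedProperConvex.subgrad_of_eq (hF : ClosedProperConvex F) {x s : Vec n} {u p : Vec m}
    {c : ℝ} (h : ∃ g ∈ subdifferential F x u, (s, (0 : Vec m)) = g + ((0 : Vec n), c • u - p)) :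
    ∃ f : ℝ, F (x, u) = f ∧ ∀ z ζ,
      ((f + (inner ℝ s (z - x) + inner ℝ (p - c • u) (ζ - u)) : ℝ) : EReal) ≤ F (z, ζ) := by
  obtain ⟨⟨g₁, g₂⟩, hg, he⟩ := h
  simp only [Prod.mk_add_mk, add_zero, Prod.mk.injEq] at he
  obtain ⟨rfl, h2⟩ := he
  have hg₂ : g₂ = p - c • u := by
    rw [← sub_eq_zero]; rw [h2]; abel
  subst hg₂
  have hg' : ∀ z ζ, F (x, u) + ((inner ℝ s (z - x) + inner ℝ (p - c • u) (ζ - u) : ℝ) : EReal)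
    ≤ F (z, ζ) := hg
  have hne : F (x, u) ≠ ⊤ := by
    intro ht
    obtain ⟨⟨z, ζ⟩, hz⟩ := hF.exists_ne_top
    have := hg' z ζ
    rw [ht, EReal.top_add_coe] at this
    exact hz (top_le_iff.1 this)
  obtain ⟨f, hf⟩ := hF.exists_eq_coe hne
  refine ⟨f, hf, fun z ζ => ?_⟩
  rw [EReal.coe_add, ← hf]
  exact hg' z ζ

/-- The linear part of the subgradient inequality passes to the limit. -/
theorem tendsto_subgrad_linear {x s : ℕ → Vec n} {u y : ℕ → Vec m} {y' : Vec m} {l : Filter ℕ}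
    (hs : Tendsto s l (𝓝 0)) (hxs : Tendsto (fun k => inner ℝ (x k) (s k)) l (𝓝 (0 : ℝ)))
    (hu : Tendsto u l (𝓝 0)) (hy : Tendsto y l (𝓝 y')) (z : Vec n) (ζ : Vec m) :
    Tendsto (fun k => inner ℝ (s k) (z - x k) + inner ℝ (y k) (ζ - u k)) l
      (𝓝 (inner ℝ y' ζ)) := by
  have h1 : Tendsto (fun k => inner ℝ (s k) z - inner ℝ (x k) (s k)) l (𝓝 (inner ℝ 0 z - 0)) :=
    (hs.inner tendsto_const_nhds).sub hxs
  have h2 := hy.inner (𝕜 := ℝ) ((tendsto_const_nhds (x := ζ)).sub hu)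
  have h3 := h1.add h2
  simp only [inner_zero_left, sub_zero, zero_add] at h3
  refine h3.congr fun k => ?_
  rw [inner_sub_right (s k), real_inner_comm (s k) (x k)]

end Duality

/-! ### The outer loop -/

/-- The step from outer iteration `k` to `k + 1` of an execution whose inner loops all terminate.
The iterates computed in outer iteration `k` carry the index `k`, and `f k` is the value of `F` at
`(x k, u k)`. -/
structure RelaxedIteration {n m : ℕ} (F : Vec n × Vec m → EReal) (cmin ε : ℝ) (c ρ f : ℕ → ℝ)
    (x s w : ℕ → Vec n) (u p pbar : ℕ → Vec m) : Prop where
  c_gt : ∀ k, cmin < c k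
  value : ∀ k, F (x k, u k) = f k
  subgrad : ∀ k z ζ, ((f k + (inner ℝ (s k) (z - x k) + inner ℝ (pbar k) (ζ - u k)) : ℝ) : EReal)
    ≤ F (z, ζ)
  inner_lt : ∀ k, |inner ℝ (x k - w k) (s k)| ≤ c k * ‖u k‖ ^ 2
  norm_s_le : ∀ k, ‖s k‖ ^ 2 ≤ ‖u k‖ ^ 2 / ε
  ρ_nonneg : ∀ k, 0 ≤ ρ k
  descent : ∀ k, c k * (ε * ‖u k‖ ^ 2) ≤ ρ k * (2 * (c k * ‖u k‖ ^ 2 -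
    |inner ℝ (x k - w k) (s k)|) - ρ k * c k * (‖u k‖ ^ 2 + ‖s k‖ ^ 2))
  w_succ : ∀ k, w (k + 1) = w k - (ρ k * c k) • s k
  p_succ : ∀ k, p (k + 1) = p k - (ρ k * c k) • u k
  pbar_eq : ∀ k, pbar k = p k - c k • u k

namespace RelaxedIteration

variable {n m : ℕ} {F : Vec n × Vec m → EReal} {cmin ε : ℝ} {c ρ f : ℕ → ℝ}
  {x s w : ℕ → Vec n} {u p pbar : ℕ → Vec m}

/-- Fejér monotonicity of `(w, p)` with respect to the solutions of the variational
inequalities. -/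
theorem fejer (h : RelaxedIteration F cmin ε c ρ f x s w u p pbar) (hcmin : 0 < cmin)
    {x' : Vec n} {p' : Vec m}
    (hvi : ∀ k, 0 ≤ inner ℝ (x k - x') (s k) + inner ℝ (pbar k - p') (u k)) (k : ℕ) :
    ‖w (k + 1) - x'‖ ^ 2 + ‖p (k + 1) - p'‖ ^ 2 + ε * ‖c k • u k‖ ^ 2 ≤
      ‖w k - x'‖ ^ 2 + ‖p k - p'‖ ^ 2 := by
  have hc : 0 < c k := hcmin.trans (h.c_gt k)
  have e1 : w (k + 1) - x' = (w k - x') - (ρ k * c k) • s k := by rw [h.w_succ]; abel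
  have e2 : p (k + 1) - p' = (p k - p') - (ρ k * c k) • u k := by rw [h.p_succ]; abel
  have e3 : inner ℝ (w k - x') (s k) = inner ℝ (x k - x') (s k) - inner ℝ (x k - w k) (s k) := by
    rw [← inner_sub_left]; congr 1; abel
  have e4 : inner ℝ (p k - p') (u k) = inner ℝ (pbar k - p') (u k) + c k * ‖u k‖ ^ 2 := by
    rw [← real_inner_self_eq_norm_sq, ← real_inner_smul_left, ← inner_add_left, h.pbar_eq]
    congr 1; abel
  rw [e1, e2, norm_sub_sq_real (w k - x'), norm_sub_sq_real (p k - p'), real_inner_smul_right, real_inner_smul_right,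
    norm_smul, norm_smul, norm_smul, mul_pow, mul_pow, mul_pow, Real.norm_eq_abs, Real.norm_eq_abs,
    sq_abs, sq_abs, e3, e4]
  have h1 := mul_le_mul_of_nonneg_left (h.descent k) hc.le
  -- The discarded terms: the variational inequality, and the replacement of ⟨x - w, s⟩ by its
  -- absolute value.
  have h2 : 0 ≤ (ρ k * c k) * ((inner ℝ (x k - x') (s k) + inner ℝ (pbar k - p') (u k)) +
      (|inner ℝ (x k - w k) (s k)| - inner ℝ (x k - w k) (s k))) :=
    mul_nonneg (mul_nonneg (h.ρ_nonneg k) hc.le)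
      (add_nonneg (hvi k) (sub_nonneg.2 (le_abs_self _)))
  nlinarith [h1, h2]

/-- The consequences of Fejér monotonicity. -/
theorem basic (h : RelaxedIteration F cmin ε c ρ f x s w u p pbar) (hcmin : 0 < cmin) (hε : 0 < ε)
    {x' : Vec n} {p' : Vec m}
    (hvi : ∀ k, 0 ≤ inner ℝ (x k - x') (s k) + inner ℝ (pbar k - p') (u k)) :
    (∃ R, ∀ k, ‖w k‖ ≤ R) ∧ (∃ R, ∀ k, ‖p k‖ ≤ R) ∧
      Tendsto (fun k => c k • u k) atTop (𝓝 0) := by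
  set V : ℕ → ℝ := fun k => ‖w k - x'‖ ^ 2 + ‖p k - p'‖ ^ 2 with hV
  have hstep : ∀ k, V (k + 1) + ε * ‖c k • u k‖ ^ 2 ≤ V k := h.fejer hcmin hvi
  have hV0 : ∀ k, 0 ≤ V k := fun k => by positivity
  have hanti : Antitone V := antitone_nat_of_succ_le fun k =>
    (le_add_of_nonneg_right (by positivity)).trans (hstep k)
  have hlim : Tendsto V atTop (𝓝 (⨅ k, V k)) :=
    tendsto_atTop_ciInf hanti ⟨0, by rintro _ ⟨k, rfl⟩; exact hV0 k⟩
  have bound : ∀ {j : ℕ} (q q' : Vec j) (k : ℕ), ‖q - q'‖ ^ 2 ≤ V k → ‖q‖ ≤ ‖q'‖ + √(V 0) := by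
    intro j q q' k hq
    have := Real.le_sqrt_of_sq_le (hq.trans (hanti (Nat.zero_le k)))
    have := norm_le_norm_add_norm_sub' q q'
    linarith
  refine ⟨⟨_, fun k => bound (w k) x' k (le_add_of_nonneg_right (by positivity))⟩,
    ⟨_, fun k => bound (p k) p' k (le_add_of_nonneg_left (by positivity))⟩, ?_⟩
  rw [tendsto_zero_iff_norm_tendsto_zero]
  have hd : Tendsto (fun k => (V k - V (k + 1)) / ε) atTop (𝓝 0) := by
    have := (hlim.sub (hlim.comp (tendsto_add_atTop_nat 1))).div_const ε
    simpa using this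
  have hsq : Tendsto (fun k => ‖c k • u k‖ ^ 2) atTop (𝓝 0) :=
    squeeze_zero (fun k => by positivity) (fun k => by
      rw [le_div_iff₀ hε]; linarith [hstep k]) hd
  simpa using hsq.sqrt

theorem tendsto_u (h : RelaxedIteration F cmin ε c ρ f x s w u p pbar) (hcmin : 0 < cmin)
    (hcu : Tendsto (fun k => c k • u k) atTop (𝓝 0)) : Tendsto u atTop (𝓝 0) := by
  have h1 := hcu.norm.div_const cmin
  rw [norm_zero, zero_div] at h1
  refine squeeze_zero_norm (fun k => ?_) h1
  have hc := hcmin.trans (h.c_gt k)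
  rw [le_div_iff₀ hcmin, norm_smul, Real.norm_eq_abs, abs_of_pos hc, mul_comm]
  exact mul_le_mul_of_nonneg_right (h.c_gt k).le (norm_nonneg _)

theorem tendsto_s (h : RelaxedIteration F cmin ε c ρ f x s w u p pbar)
    (hu : Tendsto u atTop (𝓝 0)) : Tendsto s atTop (𝓝 0) := by
  rw [tendsto_zero_iff_norm_tendsto_zero]
  have h1 : Tendsto (fun k => ‖u k‖ ^ 2 / ε) atTop (𝓝 0) := by
    simpa using (hu.norm.pow 2).div_const ε
  have h2 := squeeze_zero (fun k => by positivity) h.norm_s_le h1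
  simpa using h2.sqrt

/-- Split x = (x - w) + w: the test bounds the first part by c‖u‖² = ⟨c u, u⟩, and boundedness of w
controls the second. No bound on x is needed. -/
theorem tendsto_inner (h : RelaxedIteration F cmin ε c ρ f x s w u p pbar)
    (hcu : Tendsto (fun k => c k • u k) atTop (𝓝 0)) (hu : Tendsto u atTop (𝓝 0))
    (hs : Tendsto s atTop (𝓝 0)) {R : ℝ} (hw : ∀ k, ‖w k‖ ≤ R) :
    Tendsto (fun k => inner ℝ (x k) (s k)) atTop (𝓝 (0 : ℝ)) := by
  have h1 : Tendsto (fun k => c k * ‖u k‖ ^ 2) atTop (𝓝 0) := by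
    have := hcu.inner (𝕜 := ℝ) hu
    simpa [real_inner_smul_left, real_inner_self_eq_norm_sq] using this
  have h2 : Tendsto (fun k => R * ‖s k‖) atTop (𝓝 0) := by
    simpa using hs.norm.const_mul R
  have h3 := h1.add h2
  rw [add_zero] at h3
  refine squeeze_zero_norm (fun k => ?_) h3
  have e : inner ℝ (x k) (s k) = inner ℝ (x k - w k) (s k) + inner ℝ (w k) (s k) := by
    rw [← inner_add_left, sub_add_cancel]
  rw [e]
  refine (norm_add_le _ _).trans (add_le_add (h.inner_lt k) ?_)
  exact (norm_inner_le_norm _ _).trans (mul_le_mul_of_nonneg_right (hw k) (norm_nonneg _))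

theorem tendsto_p_sub_pbar (h : RelaxedIteration F cmin ε c ρ f x s w u p pbar)
    (hcu : Tendsto (fun k => c k • u k) atTop (𝓝 0)) :
    Tendsto (fun k => p k - pbar k) atTop (𝓝 0) := by
  simpa only [h.pbar_eq, sub_sub_cancel] using hcu

theorem exists_bound_pbar (h : RelaxedIteration F cmin ε c ρ f x s w u p pbar)
    (hcu : Tendsto (fun k => c k • u k) atTop (𝓝 0)) {R : ℝ} (hp : ∀ k, ‖p k‖ ≤ R) :
    ∃ R', ∀ k, ‖pbar k‖ ≤ R' := by
  obtain ⟨R', hR'⟩ := (Metric.isBounded_range_of_tendsto _ hcu).exists_norm_le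
  refine ⟨R + R', fun k => ?_⟩
  rw [h.pbar_eq]
  exact (norm_sub_le _ _).trans (add_le_add (hp k) (hR' _ ⟨k, rfl⟩))

/-- Monotonicity of the subdifferential along the iterates. -/
theorem monotone (h : RelaxedIteration F cmin ε c ρ f x s w u p pbar) (i j : ℕ) :
    0 ≤ (inner ℝ (s i) (x i - x j) + inner ℝ (u i) (pbar i - pbar j)) +
      (inner ℝ (s j) (x j - x i) + inner ℝ (u j) (pbar j - pbar i)) := by
  have h1 := h.subgrad i (x j) (u j)
  have h2 := h.subgrad j (x i) (u i)
  rw [h.value, EReal.coe_le_coe_iff] at h1 h2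
  simp only [inner_sub_right, real_inner_comm (u _) (pbar _)] at *
  simp only [real_inner_comm (pbar _) (u _)] at *
  linarith

/-- If `x` and `pbar` stay bounded, then the Lagrangian has a saddle point. -/
theorem exists_isSaddlePoint (h : RelaxedIteration F cmin ε c ρ f x s w u p pbar)
    (hF : ClosedProperConvex F) (hcmin : 0 < cmin) (hε : 0 < ε) {R R' : ℝ}
    (hx : ∀ k, ‖x k‖ ≤ R) (hp : ∀ k, ‖pbar k‖ ≤ R') : ∃ x' p', IsSaddlePoint F x' p' := by
  have hmem : ∀ k, (x k, pbar k) ∈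
      Metric.closedBall (0 : Vec n) R ×ˢ Metric.closedBall (0 : Vec m) R' := fun k =>
    Set.mk_mem_prod (mem_closedBall_zero_iff.2 (hx k)) (mem_closedBall_zero_iff.2 (hp k))
  have hK : IsCompact (Metric.closedBall (0 : Vec n) R ×ˢ Metric.closedBall (0 : Vec m) R') :=
    (isCompact_closedBall _ _).prod (isCompact_closedBall _ _)
  obtain ⟨⟨x', p'⟩, -, hvi⟩ := exists_forall_nonneg_of_monotone hK
    ((convex_closedBall _ _).prod (convex_closedBall _ _)) ⟨_, hmem 0⟩ (fun k => (x k, pbar k)) hmem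
    (fun k => (innerSL ℝ (s k)).coprod (innerSL ℝ (u k)))
    (fun i j => by simpa using h.monotone i j)
  obtain ⟨⟨Rw, hw⟩, -, hcu⟩ := h.basic hcmin hε (x' := x') (p' := p') (fun k => by
    have := hvi k
    rw [real_inner_comm, real_inner_comm (u k)]
    simpa using this)
  have hu := h.tendsto_u hcmin hcu
  have hs := h.tendsto_s hu
  have hxs := h.tendsto_inner hcu hu hs hw
  obtain ⟨⟨y, q⟩, -, φ, hφ, hlim⟩ := hK.tendsto_subseq hmem
  have hy : Tendsto (fun k => x (φ k)) atTop (𝓝 y) := (continuous_fst.tendsto _).comp hlim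
  have hq : Tendsto (fun k => pbar (φ k)) atTop (𝓝 q) := (continuous_snd.tendsto _).comp hlim
  have hφ' := hφ.tendsto_atTop
  -- The values `f` are not yet known to converge. The subgradient inequality bounds them above by a
  -- convergent sequence, and lower semicontinuity carries the bound to F(y, 0). Ranging over all
  -- (z, ζ), this says (0, q) ∈ ∂F(y, 0).
  have key : ∀ z ζ (t : ℝ), F (z, ζ) = t → F (y, 0) ≤ ((t - inner ℝ q ζ : ℝ) : EReal) := by
    intro z ζ t ht
    refine hF.le_of_tendsto (hy.prodMk_nhds (hu.comp hφ')) ((tendsto_const_nhds (x := t)).sub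
      (tendsto_subgrad_linear (hs.comp hφ') (hxs.comp hφ') (hu.comp hφ') hq z ζ)) fun k => ?_
    have := h.subgrad (φ k) z ζ
    rw [ht, EReal.coe_le_coe_iff] at this
    simp only [Function.comp]
    rw [h.value, EReal.coe_le_coe_iff]
    linarith
  obtain ⟨⟨z₀, ζ₀⟩, h₀⟩ := hF.exists_ne_top
  obtain ⟨t₀, ht₀⟩ := hF.exists_eq_coe h₀
  obtain ⟨v, hv⟩ := hF.exists_eq_coe
    ((key z₀ ζ₀ t₀ ht₀).trans_lt (EReal.coe_lt_top _)).ne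
  refine ⟨y, q, IsKuhnTucker.isSaddlePoint (v := v) ⟨hv, fun z ζ => ?_⟩⟩
  by_cases hz : F (z, ζ) = ⊤
  · rw [hz]; exact le_top
  · obtain ⟨t, ht⟩ := hF.exists_eq_coe hz
    have := key z ζ t ht
    rw [hv, EReal.coe_le_coe_iff] at this
    rw [ht, EReal.coe_le_coe_iff]
    linarith

/-- Monotonicity of ∂F, applied to (s, pbar) ∈ ∂F(x, u) and (0, p') ∈ ∂F(x', 0). -/
theorem variational_of_isKuhnTucker (h : RelaxedIteration F cmin ε c ρ f x s w u p pbar)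
    {x' : Vec n} {p' : Vec m} {v : ℝ} (hk : IsKuhnTucker F x' p' v) (k : ℕ) :
    0 ≤ inner ℝ (x k - x') (s k) + inner ℝ (pbar k - p') (u k) := by
  have h1 := h.subgrad k x' 0
  have h2 := hk.2 (x k) (u k)
  rw [hk.1, EReal.coe_le_coe_iff] at h1
  rw [h.value, EReal.coe_le_coe_iff] at h2
  rw [real_inner_comm, inner_sub_left]
  rw [inner_sub_right] at h1 ⊢
  simp only [zero_sub, inner_neg_right] at h1
  linarith

/-- Convergence of the values of the outer iterates. -/
theorem tendsto_value (h : RelaxedIteration F cmin ε c ρ f x s w u p pbar)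
    {x' : Vec n} {p' : Vec m} {v : ℝ} (hk : IsKuhnTucker F x' p' v)
    (hu : Tendsto u atTop (𝓝 0)) (hs : Tendsto s atTop (𝓝 0))
    (hxs : Tendsto (fun k => inner ℝ (x k) (s k)) atTop (𝓝 (0 : ℝ)))
    (hpu : Tendsto (fun k => inner ℝ (u k) (pbar k)) atTop (𝓝 (0 : ℝ))) :
    Tendsto f atTop (𝓝 v) := by
  -- Squeeze: the subgradient at (x', 0) bounds `f` from below, and the one at the iterate, tested
  -- at (x', 0), bounds it from above.
  have h1 : Tendsto (fun k => v + inner ℝ p' (u k)) atTop (𝓝 v) := by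
    simpa using (tendsto_const_nhds (x := v)).add
      ((tendsto_const_nhds (x := p')).inner (𝕜 := ℝ) hu)
  have h2 : Tendsto (fun k => v - inner ℝ x' (s k) + inner ℝ (x k) (s k) + inner ℝ (u k) (pbar k))
      atTop (𝓝 v) := by
    simpa using (((tendsto_const_nhds (x := v)).sub
      ((tendsto_const_nhds (x := x')).inner (𝕜 := ℝ) hs)).add hxs).add hpu
  refine tendsto_of_tendsto_of_tendsto_of_le_of_le h1 h2 (fun k => ?_) (fun k => ?_)
  · have := hk.2 (x k) (u k)
    rwa [h.value, EReal.coe_le_coe_iff] at this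
  · have := h.subgrad k x' 0
    rw [hk.1, EReal.coe_le_coe_iff, inner_sub_right, zero_sub, inner_neg_right,
      real_inner_comm x', real_inner_comm (x k), real_inner_comm (u k)] at this
    linarith

/-- Fenchel equality: (s, pbar) ∈ ∂F(x, u) means that the infimum defining D(s, pbar) is attained at
(x, u). -/
theorem dualFunction_eq (h : RelaxedIteration F cmin ε c ρ f x s w u p pbar) (k : ℕ) :
    dualFunction F (s k) (pbar k) =
      ((f k - inner ℝ (u k) (pbar k) - inner ℝ (x k) (s k) : ℝ) : EReal) := by
  refine le_antisymm ((iInf₂_le (x k) (u k)).trans ?_) (le_iInf₂ fun z ζ => ?_)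
  · rw [h.value, EReal.coe_sub, EReal.coe_sub]
  · rw [coe_le_sub_coe_iff, coe_le_sub_coe_iff]
    refine le_trans (EReal.coe_le_coe_iff.2 (le_of_eq ?_)) (h.subgrad k z ζ)
    rw [inner_sub_right, inner_sub_right, real_inner_comm (s k) z, real_inner_comm (s k) (x k),
      real_inner_comm (pbar k) ζ, real_inner_comm (pbar k) (u k)]
    ring

end RelaxedIteration

namespace Trace

variable {n m : ℕ} {F : Vec n × Vec m → EReal} {cmin ε : ℝ} {t : Trace n m}

/-! ### A single inner loop -/

theorem A_nonneg {k : ℕ} (hc : 0 < t.c k) (j : ℕ) : 0 ≤ t.A k j :=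
  mul_nonneg (one_div_nonneg.2 hc.le) (abs_nonneg _)

theorem Stop.U_pos {k j : ℕ} (h : t.Stop ε k j) (hc : 0 < t.c k) : 0 < t.U k j :=
  (A_nonneg hc j).trans_lt h.1

theorem Stop.U_add_S_pos {k j : ℕ} (h : t.Stop ε k j) (hc : 0 < t.c k) : 0 < t.U k j + t.S k j :=
  add_pos_of_pos_of_nonneg (h.U_pos hc) (sq_nonneg _)

theorem Stop.gammaMin_lt_one {k j : ℕ} (h : t.Stop ε k j) : t.gammaMin ε k j < 1 := by
  unfold gammaMin
  split_ifs
  · norm_num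
  · refine max_lt (by norm_num) (lt_of_le_of_lt (div_nonpos_of_nonpos_of_nonneg ?_ ?_) one_pos)
    · linarith [h.1]
    · exact Real.sqrt_nonneg _

theorem neg_one_le_gammaMin (k j : ℕ) : -1 ≤ t.gammaMin ε k j := by
  unfold gammaMin
  split_ifs
  · exact le_rfl
  · exact le_max_left _ _

theorem Stop.numerator_nonneg {k j : ℕ} (h : t.Stop ε k j) {γ : ℝ} (hγ : t.gammaMin ε k j < γ) :
    0 ≤ t.U k j - t.A k j + γ * √(t.Δ ε k j) := by
  have h1 := h.1
  unfold gammaMin at hγ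
  split_ifs at hγ with h0
  · rw [h0, Real.sqrt_zero, mul_zero]; linarith
  · have hpos : 0 < √(t.Δ ε k j) := Real.sqrt_pos.2 (h.2.lt_of_ne' h0)
    have := (div_lt_iff₀ hpos).1 ((le_max_right _ _).trans_lt hγ)
    linarith

/-- Δ is a quarter of the discriminant of (U+S)ρ² - 2(U-A)ρ + εU, and γ = ±1 gives its roots.
Multiplied by U+S, the right-hand side becomes (U-A)² - γ²Δ, which is at least (U-A)² - Δ = εU(U+S).
-/
theorem Stop.descent {k j : ℕ} (h : t.Stop ε k j) (hc : 0 < t.c k) {γ ρ : ℝ}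
    (hγ : γ ∈ Set.Ioc (t.gammaMin ε k j) 1)
    (hρ : ρ = (t.U k j - t.A k j + γ * √(t.Δ ε k j)) / (t.U k j + t.S k j)) :
    0 ≤ ρ ∧ ε * t.U k j ≤ ρ * (2 * (t.U k j - t.A k j) - ρ * (t.U k j + t.S k j)) := by
  have hpos := h.U_add_S_pos hc
  refine ⟨by rw [hρ]; exact div_nonneg (h.numerator_nonneg hγ.1) hpos.le, ?_⟩
  have hmul : ρ * (t.U k j + t.S k j) = t.U k j - t.A k j + γ * √(t.Δ ε k j) := by
    rw [hρ, div_mul_cancel₀ _ hpos.ne']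
  have hγ2 : γ ^ 2 ≤ 1 := by
    have := (neg_one_le_gammaMin k j).trans hγ.1.le
    have := hγ.2
    nlinarith
  have hsq := Real.sq_sqrt h.2
  have hΔ : t.Δ ε k j = (t.U k j - t.A k j) ^ 2 - ε * t.U k j * (t.U k j + t.S k j) := rfl
  have hle : γ ^ 2 * t.Δ ε k j ≤ t.Δ ε k j := mul_le_of_le_one_left h.2 hγ2
  refine le_of_mul_le_mul_right ?_ hpos
  calc ε * t.U k j * (t.U k j + t.S k j)
      ≤ (t.U k j - t.A k j) ^ 2 - γ ^ 2 * √(t.Δ ε k j) ^ 2 := by rw [hsq]; linarith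
    _ = (t.U k j - t.A k j + γ * √(t.Δ ε k j)) *
          (2 * (t.U k j - t.A k j) - (t.U k j - t.A k j + γ * √(t.Δ ε k j))) := by ring
    _ = _ := by rw [← hmul]; ring

/-- From Δ ≥ 0 and 0 ≤ A < U one has εU(U+S) ≤ (U-A)² ≤ U²; divide by U. -/
theorem Stop.S_le {k j : ℕ} (h : t.Stop ε k j) (hc : 0 < t.c k) (hε : 0 < ε) :
    t.S k j ≤ t.U k j / ε := by
  have hU := h.U_pos hc
  have hA := A_nonneg hc j
  have hΔ : 0 ≤ (t.U k j - t.A k j) ^ 2 - ε * t.U k j * (t.U k j + t.S k j) := h.2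
  rw [le_div_iff₀ hε]
  refine le_of_mul_le_mul_right ?_ hU
  have h1 : (t.U k j - t.A k j) ^ 2 ≤ t.U k j ^ 2 :=
    pow_le_pow_left₀ (sub_nonneg.2 h.1.le) (by linarith) 2
  nlinarith [mul_pos hε (mul_pos hU hU)]

/-- Either U ≤ A, or (U-A)² < εU(U+S); in the latter case drop A², replace εS by S and divide by U.
-/
theorem le_of_not_stop {k j : ℕ} (h : ¬ t.Stop ε k j) (hc : 0 < t.c k)
    (hε : ε ∈ Set.Ioo (0 : ℝ) 1) : (1 - ε) * t.U k j ≤ 2 * t.A k j + t.S k j := by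
  have hA := A_nonneg hc j
  have hS : 0 ≤ t.S k j := sq_nonneg _
  have hU : 0 ≤ t.U k j := sq_nonneg _
  rcases hU.eq_or_lt with hU | hU
  · rw [← hU]; linarith
  rcases le_or_gt (t.U k j) (t.A k j) with hle | hlt
  · nlinarith [hε.1]
  · have hΔ : (t.U k j - t.A k j) ^ 2 - ε * t.U k j * (t.U k j + t.S k j) < 0 := by
      by_contra! h'
      exact h ⟨hlt, h'⟩
    refine le_of_mul_le_mul_right ?_ hU
    have := mul_le_mul_of_nonneg_right hε.2.le (mul_nonneg hU.le hS)
    nlinarith [sq_nonneg (t.A k j)]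

theorem tendsto_us_of_not_terminates {k : ℕ} (hc : 0 < t.c k) (hε : ε ∈ Set.Ioo (0 : ℝ) 1)
    (hp : CompatibleProcess F (t.p k) (t.c k) (t.xs k) (t.us k) (t.ss k))
    (h : ¬ t.InnerTerminates ε k) : Tendsto (fun j => t.us k j) atTop (𝓝 0) := by
  have hA : Tendsto (fun j => t.A k j) atTop (𝓝 0) := by
    have h1 := hp.tendsto_inner.sub
      ((tendsto_const_nhds (x := t.w k)).inner (𝕜 := ℝ) hp.tendsto_s)
    simpa [A, inner_sub_left] using h1.abs.const_mul (1 / t.c k)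
  have hS : Tendsto (fun j => t.S k j) atTop (𝓝 0) := by
    simpa [S] using hp.tendsto_s.norm.pow 2
  have hb : Tendsto (fun j => (2 * t.A k j + t.S k j) / (1 - ε)) atTop (𝓝 0) := by
    simpa using ((hA.const_mul 2).add hS).div_const (1 - ε)
  have hU : Tendsto (fun j => t.U k j) atTop (𝓝 0) := by
    refine squeeze_zero' (Eventually.of_forall fun j => sq_nonneg _) ?_ hb
    filter_upwards [eventually_ge_atTop 1] with j hj
    rw [le_div_iff₀ (sub_pos.2 hε.2), mul_comm]
    exact le_of_not_stop (fun hs => h ⟨j, hj, hs⟩) hc hε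
  rw [tendsto_zero_iff_norm_tendsto_zero]
  simpa [U] using hU.sqrt

/-- The conclusions about an inner loop that runs forever. -/
theorem isDualSolution_of_tendsto_us (hF : ClosedProperConvex F) {k : ℕ}
    (hp : CompatibleProcess F (t.p k) (t.c k) (t.xs k) (t.us k) (t.ss k))
    (hu : Tendsto (fun j => t.us k j) atTop (𝓝 0)) :
    IsDualSolution F (t.p k) ∧
      limsup (fun j => F (t.xs k j, t.us k j)) atTop ≤ ⨅ x : Vec n, F (x, 0) := by
  choose f hf hsub using fun j => hF.subgrad_of_eq (hp.subgrad j)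
  have hy : Tendsto (fun j => t.p k - t.c k • t.us k j) atTop (𝓝 (t.p k)) := by
    simpa using (tendsto_const_nhds (x := t.p k)).sub (hu.const_smul (t.c k))
  have hlim := tendsto_subgrad_linear hp.tendsto_s hp.tendsto_inner hu hy
  refine ⟨fun p' => le_iInf₂ fun z ζ => ?_, le_iInf fun z => ?_⟩
  · by_cases hz : F (z, ζ) = ⊤
    · rw [hz, EReal.top_sub_coe, EReal.top_sub_coe]; exact le_top
    obtain ⟨v, hv⟩ := hF.exists_eq_coe hz
    rw [hv, ← EReal.coe_sub, ← EReal.coe_sub, inner_zero_right, sub_zero]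
    -- D(0, p') is at most F - ⟨u, p'⟩ at each inner iterate. The subgradient inequality bounds this
    -- by a sequence tending to F(z, ζ) - ⟨ζ, p⟩, in which p' no longer appears.
    have h1 := ((tendsto_const_nhds (x := v)).sub (hlim z ζ)).sub
      (hu.inner (𝕜 := ℝ) (tendsto_const_nhds (x := p')))
    rw [inner_zero_left, sub_zero, real_inner_comm] at h1
    refine ge_of_tendsto (EReal.tendsto_coe.2 h1) (Eventually.of_forall fun j => ?_)
    refine (dualFunction_zero_le p' _ _ (hf j)).trans (EReal.coe_le_coe_iff.2 ?_)
    have := hsub j z ζ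
    rw [hv, EReal.coe_le_coe_iff] at this
    linarith
  · by_cases hz : F (z, 0) = ⊤
    · rw [hz]; exact le_top
    obtain ⟨v, hv⟩ := hF.exists_eq_coe hz
    have h1 := (tendsto_const_nhds (x := v)).sub (hlim z 0)
    rw [inner_zero_right, sub_zero] at h1
    rw [hv, ← (EReal.tendsto_coe.2 h1).limsup_eq]
    refine limsup_le_limsup (Eventually.of_forall fun j => ?_)
    have := hsub j z 0
    rw [hv, EReal.coe_le_coe_iff] at this
    show F _ ≤ _
    rw [hf, EReal.coe_le_coe_iff]
    linarith

/-! ### Executions without infinite inner loops -/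

theorem InnerTerminates.exists_stopsAt {k : ℕ} (h : t.InnerTerminates ε k) :
    ∃ j, t.StopsAt ε k j := by
  classical
  refine ⟨Nat.find h, (Nat.find_spec h).1, (Nat.find_spec h).2, fun i hi hlt hs => ?_⟩
  exact Nat.find_min h hlt ⟨hi, hs⟩

theorem IsExecution.exists_relaxedIteration (ht : t.IsExecution F cmin ε)
    (hF : ClosedProperConvex F) (hcmin : 0 < cmin) (hε : 0 < ε)
    (h : ∀ k, t.InnerTerminates ε k) :
    ∃ f, RelaxedIteration F cmin ε t.c t.ρ f (fun k => t.x (k + 1)) (fun k => t.s (k + 1)) t.w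
      (fun k => t.u (k + 1)) t.p t.pbar := by
  have hr : ∀ k, t.Reached ε k := fun k i _ => h i
  choose j hj using fun k => (h k).exists_stopsAt
  have hc : ∀ k, 0 < t.c k := fun k => hcmin.trans (ht.c_gt k (hr k))
  have ex := fun k => ht.x_succ k _ (hr k) (hj k)
  have eu := fun k => ht.u_succ k _ (hr k) (hj k)
  have es := fun k => ht.s_succ k _ (hr k) (hj k)
  have ep := fun k => ht.pbar_eq k _ (hr k) (hj k)
  have htest := fun k => (hj k).2.1
  have hU : ∀ k, ‖t.u (k + 1)‖ ^ 2 = t.U k (j k) := fun k => by rw [eu]; rfl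
  have hS : ∀ k, ‖t.s (k + 1)‖ ^ 2 = t.S k (j k) := fun k => by rw [es]; rfl
  have hA : ∀ k, |inner ℝ (t.x (k + 1) - t.w k) (t.s (k + 1))| = t.c k * t.A k (j k) := fun k => by
    rw [ex, es, A, ← mul_assoc, mul_one_div_cancel (hc k).ne', one_mul]
  choose f hf hsub using fun k => hF.subgrad_of_eq ((ht.process k (hr k)).subgrad (j k))
  have hd := fun k => (htest k).descent (hc k) (ht.γ_mem k _ (hr k) (hj k))
    (ht.ρ_eq k _ (hr k) (hj k))
  refine ⟨f, fun k => ht.c_gt k (hr k), fun k => ?_, fun k => ?_, fun k => ?_, fun k => ?_,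
    fun k => (hd k).1, fun k => ?_, fun k => ht.w_succ k _ (hr k) (hj k), fun k => ?_, ep⟩
  · simp only [ex, eu]; exact hf k
  · simp only [ex, eu, es, ep]; exact hsub k
  · simp only [hA, hU]
    exact mul_le_mul_of_nonneg_left (htest k).1.le (hc k).le
  · simp only [hU, hS]; exact (htest k).S_le (hc k) hε
  · simp only [hA, hU, hS]
    have := mul_le_mul_of_nonneg_left (hd k).2 (hc k).le
    linarith
  · rw [ht.p_succ k _ (hr k) (hj k), ep, smul_sub, sub_smul, one_smul, smul_smul]
    abel

theorem converges_of_isKuhnTucker (hF : ClosedProperConvex F) (hcmin : 0 < cmin) (hε : 0 < ε)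
    {f : ℕ → ℝ} (h : RelaxedIteration F cmin ε t.c t.ρ f (fun k => t.x (k + 1))
      (fun k => t.s (k + 1)) t.w (fun k => t.u (k + 1)) t.p t.pbar)
    {x' : Vec n} {p' : Vec m} {v : ℝ} (hk : IsKuhnTucker F x' p' v) : t.Converges F := by
  obtain ⟨⟨Rw, hw⟩, ⟨Rp, hp⟩, hcu⟩ := h.basic hcmin hε (h.variational_of_isKuhnTucker hk)
  obtain ⟨R, hpbar⟩ := h.exists_bound_pbar hcu hp
  have hu := h.tendsto_u hcmin hcu
  have hs := h.tendsto_s hu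
  have hxs := h.tendsto_inner hcu hu hs hw
  have hpu : Tendsto (fun k => inner ℝ (t.u (k + 1)) (t.pbar k)) atTop (𝓝 (0 : ℝ)) := by
    have h1 : Tendsto (fun k => ‖t.u (k + 1)‖ * R) atTop (𝓝 0) := by
      simpa using hu.norm.mul_const R
    exact squeeze_zero_norm (fun k => (norm_inner_le_norm _ _).trans
      (mul_le_mul_of_nonneg_left (hpbar k) (norm_nonneg _))) h1
  have hf := h.tendsto_value hk hu hs hxs hpu
  have hbdd : ∀ {i : ℕ} {q : ℕ → Vec i} {R : ℝ}, (∀ k, ‖q k‖ ≤ R) →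
      Bornology.IsBounded (Set.range q) := fun hq =>
    isBounded_iff_forall_norm_le.2 ⟨_, by rintro _ ⟨k, rfl⟩; exact hq k⟩
  have hdual : ∀ q, MapClusterPt q atTop t.pbar → IsDualSolution F q := by
    intro q hq p''
    obtain ⟨φ, hφ, hlim⟩ := hq.tendsto_subseq
    have hφ' := hφ.tendsto_atTop
    -- In the limit the subgradient inequality reads v + ⟨q, ζ⟩ ≤ F(z, ζ), so q attains the dual
    -- value.
    have hle : (v : EReal) ≤ dualFunction F 0 q := coe_le_dualFunction_zero fun z ζ => by
      refine le_of_tendsto (EReal.tendsto_coe.2 ((hf.comp hφ').add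
        (tendsto_subgrad_linear (hs.comp hφ') (hxs.comp hφ') (hu.comp hφ') hlim z ζ)))
        (Eventually.of_forall fun k => h.subgrad (φ k) z ζ)
    exact ((le_iSup (dualFunction F 0) p'').trans hk.dualValue_eq.le).trans hle
  refine ⟨hbdd hpbar, hbdd hp, hbdd hw, hu, hcu, hs,
    ⟨v, hk.primalValue_eq, hk.dualValue_eq, ?_, ?_⟩, ?_, hdual, ?_⟩
  · simp only [h.value]
    exact EReal.tendsto_coe.2 hf
  · simp only [h.dualFunction_eq]
    refine EReal.tendsto_coe.2 ?_
    simpa using (hf.sub hpu).sub hxs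
  · intro y hy z
    obtain ⟨φ, hφ, hlim⟩ := hy.tendsto_subseq
    have hφ' := hφ.tendsto_atTop
    have := hF.le_of_tendsto (hlim.prodMk_nhds (hu.comp hφ')) (hf.comp hφ')
      (fun k => (h.value (φ k)).le)
    exact this.trans (hk.primalValue_eq.symm.le.trans (iInf_le _ z))
  · intro q hq
    refine hdual q ?_
    obtain ⟨φ, hφ, hlim⟩ := hq.tendsto_subseq
    have hφ' := hφ.tendsto_atTop
    have h1 : Tendsto (fun k => t.pbar (φ k)) atTop (𝓝 q) := by
      simpa using hlim.sub ((h.tendsto_p_sub_pbar hcu).comp hφ')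
    exact MapClusterPt.of_comp hφ' h1.mapClusterPt

end Trace

end AdaptiveRelax

end

theorem proposition3p6 {n m : ℕ}
    (F : AdaptiveRelax.Vec n × AdaptiveRelax.Vec m → EReal)
    (hF : AdaptiveRelax.ClosedProperConvex F)
    (cmin : ℝ) (hcmin : 0 < cmin) (ε : ℝ) (hε : ε ∈ Set.Ioo (0 : ℝ) 1)
    (t : AdaptiveRelax.Trace n m) (ht : t.IsExecution F cmin ε) :
    -- the updates after an inner loop are always possible
    (∀ k j, t.Reached ε k → 1 ≤ j → t.Stop ε k j →
      (Set.Ioc (t.gammaMin ε k j) 1).Nonempty ∧ 0 < t.U k j + t.S k j) ∧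
    -- (i) all inner loops terminate, and the outer loop runs forever
    (((∀ k, t.Reached ε k ∧ t.InnerTerminates ε k) ∧
        ((∃ x p, AdaptiveRelax.IsSaddlePoint F x p) → t.Converges F) ∧
        ((¬ ∃ x p, AdaptiveRelax.IsSaddlePoint F x p) →
          ¬ Bornology.IsBounded (Set.range fun k => t.x (k + 1)) ∨
            ¬ Bornology.IsBounded (Set.range t.pbar))) ∨
    -- (ii) the algorithm enters an inner loop that runs forever
      (∃ k, t.Reached ε k ∧ ¬ t.InnerTerminates ε k ∧
        AdaptiveRelax.IsDualSolution F (t.p k) ∧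
        limsup (fun j => F (t.xs k j, t.us k j)) atTop ≤
          (⨅ x : AdaptiveRelax.Vec n, F (x, 0)) ∧
        Tendsto (fun j => t.us k j) atTop (𝓝 0))) := by
  have hc : ∀ k, t.Reached ε k → 0 < t.c k := fun k hr => hcmin.trans (ht.c_gt k hr)
  refine ⟨fun k j hr _ hs =>
    ⟨⟨1, hs.gammaMin_lt_one, le_rfl⟩, hs.U_add_S_pos (hc k hr)⟩, ?_⟩
  by_cases hall : ∀ k, t.InnerTerminates ε k
  · left
    obtain ⟨f, h⟩ := ht.exists_relaxedIteration hF hcmin hε.1 hall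
    refine ⟨fun k => ⟨fun i _ => hall i, hall k⟩, ?_, fun hno => ?_⟩
    · rintro ⟨x, p, hxp⟩
      obtain ⟨v, hv⟩ := hxp.exists_isKuhnTucker hF
      exact AdaptiveRelax.Trace.converges_of_isKuhnTucker hF hcmin hε.1 h hv
    · by_contra! hcon
      obtain ⟨R, hR⟩ := hcon.1.exists_norm_le
      obtain ⟨R', hR'⟩ := hcon.2.exists_norm_le
      exact hno (h.exists_isSaddlePoint hF hcmin hε.1 (fun k => hR _ ⟨k, rfl⟩)
        (fun k => hR' _ ⟨k, rfl⟩))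
  · right
    classical
    push Not at hall
    have hr : t.Reached ε (Nat.find hall) := fun i hi => not_not.1 (Nat.find_min hall hi)
    have hp := ht.process _ hr
    have hu := AdaptiveRelax.Trace.tendsto_us_of_not_terminates (hc _ hr) hε hp
      (Nat.find_spec hall)
    obtain ⟨hd, hl⟩ := AdaptiveRelax.Trace.isDualSolution_of_tendsto_us hF hp hu
    exact ⟨_, hr, Nat.find_spec hall, hd, hl, hu⟩
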